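/- Let $n\ge 1$ be an integer, put $\lambda_n=n^2$, and let $T_n$ and $U_{n-1}$ be the Chebyshev polynomials of the first and second kind. Consider the Chebyshev differential equation $$y''-\frac{x}{1-x^{2}}\,y'+\frac{\lambda_n}{1-x^{2}}\,y=0 .$$ 1. Let $K=\mathbb{C}(x)$ with the derivation $d/dx$. A Picard--Vessiot extension of $K$ for this equation is a differential field extension $L/K$ that has no constants other than those of $K$ and is generated over $K$, as a differential field, by two solutions that are linearly independent over the constants. Such an extension exists, and for every such $L$ the differential Galois group $G(L/K)$, i.e. the group of $K$-automorphisms of $L$ that commute with the derivation, is isomorphic to $\mathbb{Z}_2$. 2. Let $\Omega\subseteq\mathbb{C}$ be a nonempty open set and $\sqrt{1-x^2}$ a holomorphic branch of the square root on $\Omega$. By a first integral of a vector field on a nonempty open set $D\subseteq\mathbb{C}^2$ we mean a holomorphic function on $D$ whose derivative along the vector field vanishes on $D$ and which is not constant on any nonempty open subset of $D$. (a) On the set of all $(w,x)\in\mathbb{C}\times\Omega$ at which none of the denominators below vanishes, the function $$I(w,x)=\frac{-w+\dfrac{U_{n-1}'(x)}{U_{n-1}(x)}-\dfrac{3x}{2(1-x^{2})}}{-w+\dfrac{T_n'(x)}{T_n(x)}-\dfrac{x}{2(1-x^{2})}}\cdot\frac{U_{n-1}(x)}{T_n(x)}\sqrt{1-x^{2}}$$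 is a first integral of the system $$\dot w=-2-4\lambda_n+(4\lambda_n-1)x^{2}-4(1-x^{2})^{2}w^{2},\qquad \dot x=4(1-x^{2})^{2}.$$ (b) Let $\mu\in\mathbb{C}$, $\mu\neq0$. On the set of all $(v,x)\in\mathbb{C}\times\Omega$ at which the denominator below does not vanish, the function $$I(v,x)=\frac{U_{n-1}'(x)(1-x^{2})+U_{n-1}(x)(\mu v-x)}{T_n'(x)(1-x^{2})+\mu\, T_n(x)\,v}\cdot\sqrt{1-x^{2}}$$ is a first integral of the system $$\dot v=\frac{\lambda_n}{\mu}(1-x^{2})-xv+\mu v^{2},\qquad \dot x=1-x^{2}.$$ -/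

import Mathlib

open Polynomial
open scoped Differential

noncomputable section

namespace ChebyshevGalois

/-! ### The differential field `ℂ(x)` -/

/-- The derivative `d/dx` of a rational function, by the quotient rule. -/
def ratDeriv (f : RatFunc ℂ) : RatFunc ℂ :=
  (algebraMap ℂ[X] (RatFunc ℂ) (derivative f.num) * algebraMap ℂ[X] (RatFunc ℂ) f.denom
    - algebraMap ℂ[X] (RatFunc ℂ) f.num * algebraMap ℂ[X] (RatFunc ℂ) (derivative f.denom))
    / algebraMap ℂ[X] (RatFunc ℂ) f.denom ^ 2

/-- The quotient rule holds for every representation as a fraction of polynomials. -/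
theorem ratDeriv_div (p q : ℂ[X]) (hq : q ≠ 0) :
    ratDeriv (algebraMap ℂ[X] (RatFunc ℂ) p / algebraMap ℂ[X] (RatFunc ℂ) q) =
      (algebraMap ℂ[X] (RatFunc ℂ) (derivative p) * algebraMap ℂ[X] (RatFunc ℂ) q
        - algebraMap ℂ[X] (RatFunc ℂ) p * algebraMap ℂ[X] (RatFunc ℂ) (derivative q))
        / algebraMap ℂ[X] (RatFunc ℂ) q ^ 2 := by
  set f : RatFunc ℂ := algebraMap ℂ[X] (RatFunc ℂ) p / algebraMap ℂ[X] (RatFunc ℂ) q with hf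
  have hd : f.denom ≠ 0 := RatFunc.denom_ne_zero f
  have hd' : algebraMap ℂ[X] (RatFunc ℂ) f.denom ≠ 0 := RatFunc.algebraMap_ne_zero hd
  have hq' : algebraMap ℂ[X] (RatFunc ℂ) q ≠ 0 := RatFunc.algebraMap_ne_zero hq
  have h1 : f.num * q = p * f.denom := by
    apply RatFunc.algebraMap_injective (K := ℂ)
    have := RatFunc.num_div_denom f
    rw [div_eq_iff hd'] at this
    rw [map_mul, map_mul, this, hf]
    field_simp
  have h2 : derivative f.num * q + f.num * derivative q
      = derivative p * f.denom + p * derivative f.denom := by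
    rw [← derivative_mul, ← derivative_mul, h1]
  have h3 : (derivative f.num * f.denom - f.num * derivative f.denom) * q ^ 2
      = (derivative p * q - p * derivative q) * f.denom ^ 2 := by
    linear_combination (f.denom * q) * h2 - (derivative f.denom * q + f.denom * derivative q) * h1
  unfold ratDeriv
  rw [div_eq_div_iff (pow_ne_zero 2 hd') (pow_ne_zero 2 hq')]
  simpa only [map_mul, map_sub, map_pow] using congrArg (algebraMap ℂ[X] (RatFunc ℂ)) h3

theorem ratDeriv_add (f g : RatFunc ℂ) : ratDeriv (f + g) = ratDeriv f + ratDeriv g := by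
  have hf : algebraMap ℂ[X] (RatFunc ℂ) f.denom ≠ 0 :=
    RatFunc.algebraMap_ne_zero (RatFunc.denom_ne_zero f)
  have hg : algebraMap ℂ[X] (RatFunc ℂ) g.denom ≠ 0 :=
    RatFunc.algebraMap_ne_zero (RatFunc.denom_ne_zero g)
  have h : f + g = algebraMap ℂ[X] (RatFunc ℂ) (f.num * g.denom + g.num * f.denom)
      / algebraMap ℂ[X] (RatFunc ℂ) (f.denom * g.denom) := by
    conv_lhs => rw [← RatFunc.num_div_denom f, ← RatFunc.num_div_denom g]
    simp only [map_mul, map_add]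
    field_simp
  rw [h, ratDeriv_div _ _ (mul_ne_zero (RatFunc.denom_ne_zero f) (RatFunc.denom_ne_zero g))]
  unfold ratDeriv
  simp only [derivative_mul, map_mul, map_add]
  field_simp
  ring

theorem ratDeriv_mul (f g : RatFunc ℂ) :
    ratDeriv (f * g) = f * ratDeriv g + g * ratDeriv f := by
  have hf : algebraMap ℂ[X] (RatFunc ℂ) f.denom ≠ 0 :=
    RatFunc.algebraMap_ne_zero (RatFunc.denom_ne_zero f)
  have hg : algebraMap ℂ[X] (RatFunc ℂ) g.denom ≠ 0 :=
    RatFunc.algebraMap_ne_zero (RatFunc.denom_ne_zero g)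
  have h : f * g = algebraMap ℂ[X] (RatFunc ℂ) (f.num * g.num)
      / algebraMap ℂ[X] (RatFunc ℂ) (f.denom * g.denom) := by
    conv_lhs => rw [← RatFunc.num_div_denom f, ← RatFunc.num_div_denom g]
    simp only [map_mul]
    field_simp
  have e : f * ratDeriv g + g * ratDeriv f =
      (algebraMap ℂ[X] (RatFunc ℂ) f.num / algebraMap ℂ[X] (RatFunc ℂ) f.denom) * ratDeriv g
      + (algebraMap ℂ[X] (RatFunc ℂ) g.num / algebraMap ℂ[X] (RatFunc ℂ) g.denom) * ratDeriv f := by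
    rw [RatFunc.num_div_denom, RatFunc.num_div_denom]
  rw [e, h, ratDeriv_div _ _ (mul_ne_zero (RatFunc.denom_ne_zero f) (RatFunc.denom_ne_zero g))]
  unfold ratDeriv
  simp only [derivative_mul, map_mul, map_add]
  field_simp
  ring

/-- The differential ring structure given by an additive map with the Leibniz rule. -/
abbrev differentialOfLeibniz {R : Type*} [CommRing R] (d : R → R)
    (hadd : ∀ a b, d (a + b) = d a + d b) (hmul : ∀ a b, d (a * b) = a * d b + b * d a) :
    Differential R where
  deriv := Derivation.mk' (AddMonoidHom.mk' d hadd).toIntLinearMap hmul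

/-- `ℂ(x)` as a differential field with the derivation `d/dx`. -/
instance ratDifferential : Differential (RatFunc ℂ) :=
  differentialOfLeibniz ratDeriv ratDeriv_add ratDeriv_mul

/-! ### Picard–Vessiot extensions and the differential Galois group -/

/-- `y` solves `y'' + a y' + b y = 0`, where `a`, `b` lie in the base field `K`. -/
def IsSolution {K L : Type*} [Field K] [Field L] [Differential L] [Algebra K L]
    (a b : K) (y : L) : Prop :=
  y′′ + algebraMap K L a * y′ + algebraMap K L b * y = 0

/-- The differential field extension `L / K` is a Picard–Vessiot extension for
`y'' + a y' + b y = 0`: it has no new constants, and it is generated over `K` as a differential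
field by two solutions that are linearly independent over the constants. -/
structure IsPicardVessiot {K : Type*} (L : Type*) [Field K] [Field L] [Differential K]
    [Differential L] [Algebra K L] [DifferentialAlgebra K L] (a b : K) : Prop where
  no_new_constants : ∀ c : L, c′ = 0 → ∃ d : K, d′ = 0 ∧ algebraMap K L d = c
  generated : ∃ y₁ y₂ : L, IsSolution a b y₁ ∧ IsSolution a b y₂ ∧
    (∀ c₁ c₂ : L, c₁′ = 0 → c₂′ = 0 → c₁ * y₁ + c₂ * y₂ = 0 → c₁ = 0 ∧ c₂ = 0) ∧
    IntermediateField.adjoin K {y₁, y₂, y₁′, y₂′} = ⊤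

/-- The differential Galois group `G(L/K)`: the `K`-automorphisms of `L` that commute with the
derivation. -/
def diffGaloisGroup (K L : Type*) [Field K] [Field L] [Differential L] [Algebra K L] :
    Subgroup (L ≃ₐ[K] L) where
  carrier := {σ | ∀ y : L, σ (y′) = (σ y)′}
  one_mem' := fun _ => rfl
  mul_mem' := by
    intro σ τ hσ hτ y
    rw [AlgEquiv.mul_apply, AlgEquiv.mul_apply, hτ, hσ]
  inv_mem' := by
    intro σ hσ y
    have key : σ.symm (y′) = (σ.symm y)′ := by
      apply σ.injective
      rw [hσ, AlgEquiv.apply_symm_apply, AlgEquiv.apply_symm_apply]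
    exact key

/-- The coefficient `-x / (1 - x²)` of `y'` in the Chebyshev equation. -/
def chebA : RatFunc ℂ := -(RatFunc.X / (1 - RatFunc.X ^ 2))

/-- The coefficient `n² / (1 - x²)` of `y` in the Chebyshev equation. -/
def chebB (n : ℕ) : RatFunc ℂ := (n : RatFunc ℂ) ^ 2 / (1 - RatFunc.X ^ 2)

/-! ### First integrals of planar complex vector fields -/

/-- `I` is a (holomorphic) first integral on the nonempty open set `D ⊆ ℂ²` of the vector field
`V`: its derivative along `V` vanishes on `D`, and it is not constant on any nonempty open
subset of `D`. -/
structure IsFirstIntegral (V : ℂ × ℂ → ℂ × ℂ) (D : Set (ℂ × ℂ)) (I : ℂ × ℂ → ℂ) : Prop where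
  isOpen : IsOpen D
  nonempty : D.Nonempty
  differentiableOn : DifferentiableOn ℂ I D
  lie_eq_zero : ∀ p ∈ D, fderiv ℂ I p (V p) = 0
  not_constant : ∀ W : Set (ℂ × ℂ), IsOpen W → W.Nonempty → W ⊆ D →
    ¬ ∃ c : ℂ, ∀ p ∈ W, I p = c

/-- `s` is a holomorphic branch of `√(1 - x²)` on the nonempty open set `Ω ⊆ ℂ`. -/
structure IsSqrtBranch (Ω : Set ℂ) (s : ℂ → ℂ) : Prop where
  isOpen : IsOpen Ω
  nonempty : Ω.Nonempty
  differentiableOn : DifferentiableOn ℂ s Ω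
  sq_eq : ∀ x ∈ Ω, s x ^ 2 = 1 - x ^ 2

/-- `T_n(x)`. -/
def chebT (n : ℕ) (x : ℂ) : ℂ := (Chebyshev.T ℂ (n : ℤ)).eval x

/-- `T_n'(x)`. -/
def chebT' (n : ℕ) (x : ℂ) : ℂ := (derivative (Chebyshev.T ℂ (n : ℤ))).eval x

/-- `U_{n-1}(x)`. -/
def chebU (n : ℕ) (x : ℂ) : ℂ := (Chebyshev.U ℂ ((n : ℤ) - 1)).eval x

/-- `U_{n-1}'(x)`. -/
def chebU' (n : ℕ) (x : ℂ) : ℂ := (derivative (Chebyshev.U ℂ ((n : ℤ) - 1))).eval x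

/-- The reduced system, in the coordinates `p = (w, x)`. -/
def reducedField (n : ℕ) (p : ℂ × ℂ) : ℂ × ℂ :=
  (-2 - 4 * (n : ℂ) ^ 2 + (4 * (n : ℂ) ^ 2 - 1) * p.2 ^ 2 - 4 * (1 - p.2 ^ 2) ^ 2 * p.1 ^ 2,
    4 * (1 - p.2 ^ 2) ^ 2)

/-- The associated quadratic system, in the coordinates `p = (v, x)`. -/
def quadraticField (n : ℕ) (μ : ℂ) (p : ℂ × ℂ) : ℂ × ℂ :=
  ((n : ℂ) ^ 2 / μ * (1 - p.2 ^ 2) - p.2 * p.1 + μ * p.1 ^ 2, 1 - p.2 ^ 2)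

/-- The denominator of the first factor of `reducedIntegral`. -/
def reducedDen (n : ℕ) (p : ℂ × ℂ) : ℂ :=
  -p.1 + chebT' n p.2 / chebT n p.2 - p.2 / (2 * (1 - p.2 ^ 2))

/-- The first integral of the reduced system, for the branch `s` of `√(1 - x²)`. -/
def reducedIntegral (n : ℕ) (s : ℂ → ℂ) (p : ℂ × ℂ) : ℂ :=
  (-p.1 + chebU' n p.2 / chebU n p.2 - 3 * p.2 / (2 * (1 - p.2 ^ 2))) / reducedDen n p
    * (chebU n p.2 / chebT n p.2) * s p.2

/-- The points over `Ω` at which no denominator in `reducedIntegral` vanishes. -/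
def reducedDomain (n : ℕ) (Ω : Set ℂ) : Set (ℂ × ℂ) :=
  {p | p.2 ∈ Ω ∧ 1 - p.2 ^ 2 ≠ 0 ∧ chebT n p.2 ≠ 0 ∧ chebU n p.2 ≠ 0 ∧ reducedDen n p ≠ 0}

/-- The denominator of `quadraticIntegral`. -/
def quadraticDen (n : ℕ) (μ : ℂ) (p : ℂ × ℂ) : ℂ :=
  chebT' n p.2 * (1 - p.2 ^ 2) + μ * chebT n p.2 * p.1

/-- The first integral of the quadratic system, for the branch `s` of `√(1 - x²)`. -/
def quadraticIntegral (n : ℕ) (μ : ℂ) (s : ℂ → ℂ) (p : ℂ × ℂ) : ℂ :=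
  (chebU' n p.2 * (1 - p.2 ^ 2) + chebU n p.2 * (μ * p.1 - p.2)) / quadraticDen n μ p * s p.2

/-- The points over `Ω` at which the denominator of `quadraticIntegral` does not vanish. -/
def quadraticDomain (n : ℕ) (μ : ℂ) (Ω : Set ℂ) : Set (ℂ × ℂ) :=
  {p | p.2 ∈ Ω ∧ quadraticDen n μ p ≠ 0}

end ChebyshevGalois

end

noncomputable section

namespace ChebyshevGalois

/-! ### Chebyshev polynomials -/

/-! With `x = cos θ` the equation is the harmonic oscillator, and `T_n` and `Y = U_{n-1} √(1-x²)`
are `cos nθ` and `sin nθ`. The Wronskian `w` of two solutions satisfies `(1-x²) w' = x w`, so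
`(1-x²) w²` is constant. In a Picard–Vessiot extension `L` some `w` is nonzero and the constants are
those of `ℂ(x)`, namely `ℂ`. Extracting a complex square root of that constant puts `s = √(1-x²)` in
`L` (`IsPicardVessiot.exists_sqrt`). Conversely, by Cramer's rule, every solution is a constant
combination of `T_n` and `Y`, so `L = ℂ(x)(s)` (`mem_adjoin_sqrt`). Since `1-x²` is not a square in
`ℂ(x)`, the extension is quadratic, and its automorphisms all commute with the derivation. Existence
follows by adjoining `s` and checking that no constants appear. Each first integral is a ratio of
Wronskians of `Y` and `T_n` against a third solution, written through its logarithmic derivative,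
which satisfies a Riccati equation. It is a Möbius function of the first variable. The Pell identity
makes the determinant nonzero, hence the function is nonconstant on open sets
(`isFirstIntegral_of_moebius`). -/

theorem chebyshev_pell (n : ℕ) :
    Chebyshev.T ℂ (n : ℤ) ^ 2 + (1 - X ^ 2) * Chebyshev.U ℂ ((n : ℤ) - 1) ^ 2 = 1 := by
  induction n with
  | zero => simp
  | succ k ih =>
    have h1 := Chebyshev.T_eq_X_mul_T_sub_pol_U ℂ ((k : ℤ) - 1)
    have h2 := Chebyshev.U_eq_X_mul_U_add_T ℂ ((k : ℤ) - 1)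
    rw [show (k : ℤ) - 1 + 2 = (k + 1 : ℕ) by push_cast; ring, sub_add_cancel] at h1
    rw [sub_add_cancel] at h2
    rw [show ((k + 1 : ℕ) : ℤ) - 1 = k by push_cast; ring, h1, h2]
    -- The recurrences are multiplication by `X + i √(1-X²)`, whose norm `X² + (1-X²)` is `1`.
    linear_combination ih

theorem derivative_chebyshevT (n : ℕ) :
    derivative (Chebyshev.T ℂ (n : ℤ)) = n * Chebyshev.U ℂ ((n : ℤ) - 1) := by
  simpa using Chebyshev.T_derivative_eq_U (R := ℂ) (n : ℤ)

theorem one_sub_X_sq_mul_derivative_chebyshevU (n : ℕ) :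
    (1 - X ^ 2) * derivative (Chebyshev.U ℂ ((n : ℤ) - 1)) =
      X * Chebyshev.U ℂ ((n : ℤ) - 1) - (n : ℂ[X]) * Chebyshev.T ℂ (n : ℤ) := by
  have h := Chebyshev.add_one_mul_T_eq_poly_in_U (R := ℂ) ((n : ℤ) - 1)
  rw [sub_add_cancel] at h
  push_cast at h
  linear_combination h

theorem chebyshevT_ne_zero (n : ℕ) : Chebyshev.T ℂ (n : ℤ) ≠ 0 := by
  intro h
  have := congrArg (eval 1) h
  simp at this

theorem chebyshevU_ne_zero {n : ℕ} (hn : 1 ≤ n) : Chebyshev.U ℂ ((n : ℤ) - 1) ≠ 0 := by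
  intro h
  have := congrArg (eval 1) h
  simp at this
  omega

/-! ### Rational functions -/

theorem deriv_algebraMap_polynomial (p : ℂ[X]) :
    (algebraMap ℂ[X] (RatFunc ℂ) p)′ = algebraMap ℂ[X] (RatFunc ℂ) (derivative p) := by
  have := ratDeriv_div p 1 one_ne_zero
  simp only [map_one, div_one, derivative_one, map_zero, mul_one, mul_zero, sub_zero,
    one_pow] at this
  exact this

/-- The quotient rule and coprimality give `denom ∣ denom'`. By degree `denom' = 0`, so the monic
denominator is `1`; then the numerator has zero derivative. -/
theorem eq_C_of_deriv_eq_zero {f : RatFunc ℂ} (hf : f′ = 0) : ∃ c : ℂ, f = RatFunc.C c := by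
  have hd : algebraMap ℂ[X] (RatFunc ℂ) f.denom ≠ 0 :=
    RatFunc.algebraMap_ne_zero (RatFunc.denom_ne_zero f)
  have h0 : ratDeriv f = 0 := hf
  rw [ratDeriv, div_eq_zero_iff, or_iff_left (pow_ne_zero 2 hd), ← map_mul, ← map_mul,
    ← map_sub, map_eq_zero_iff _ (RatFunc.algebraMap_injective ℂ), sub_eq_zero] at h0
  have hdvd : f.denom ∣ derivative f.denom :=
    (RatFunc.isCoprime_num_denom f).symm.dvd_of_dvd_mul_left
      (h0 ▸ dvd_mul_left f.denom (derivative f.num))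
  have hden : f.denom = 1 := by
    by_contra hne
    have hpos : 0 < f.denom.natDegree := by
      rcases Nat.eq_zero_or_pos f.denom.natDegree with h | h
      · exact absurd ((Monic.natDegree_eq_zero (RatFunc.monic_denom f)).mp h) hne
      · exact h
    have hz : derivative f.denom = 0 :=
      eq_zero_of_dvd_of_natDegree_lt hdvd (natDegree_derivative_lt hpos.ne')
    have := derivative_eq_zero.mp hz
    omega
  rw [hden] at h0
  simp only [mul_one, derivative_one, mul_zero] at h0
  refine ⟨f.num.coeff 0, ?_⟩
  conv_lhs => rw [← RatFunc.num_div_denom f, hden, map_one, div_one,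
    eq_C_of_natDegree_eq_zero (derivative_eq_zero.mp h0)]
  exact RatFunc.algebraMap_C _

theorem one_sub_X_sq_eq :
    (1 - RatFunc.X ^ 2 : RatFunc ℂ) = algebraMap ℂ[X] (RatFunc ℂ) (1 - X ^ 2) := by
  simp [RatFunc.algebraMap_X]

theorem one_sub_X_sq_ne_zero : (1 - RatFunc.X ^ 2 : RatFunc ℂ) ≠ 0 := by
  rw [one_sub_X_sq_eq]
  refine RatFunc.algebraMap_ne_zero fun h => ?_
  have := congrArg (eval 0) h
  simp at this

/-- As `ℂ[X]` is integrally closed, a root would be a polynomial `p` with `p(1) = 0`. Then `(p²)'`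
vanishes at `1`, where `1 - X²` has derivative `-2`. -/
theorem sq_ne_one_sub_X_sq (f : RatFunc ℂ) : f ^ 2 ≠ 1 - RatFunc.X ^ 2 := by
  intro h
  rw [one_sub_X_sq_eq] at h
  obtain ⟨p, rfl⟩ := IsIntegrallyClosed.exists_algebraMap_eq_of_isIntegral_pow
    (R := ℂ[X]) (x := f) two_pos (h ▸ isIntegral_algebraMap)
  have hp : p ^ 2 = 1 - X ^ 2 := RatFunc.algebraMap_injective ℂ (by rw [map_pow, h])
  have h1 : eval 1 p = 0 := by
    have := congrArg (eval 1) hp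
    simpa using this
  have h2 := congrArg (fun r => eval 1 (derivative r)) hp
  simp [sq, h1, derivative_mul] at h2
  norm_num at h2

theorem deriv_X : (RatFunc.X : RatFunc ℂ)′ = 1 := by
  rw [← RatFunc.algebraMap_X, deriv_algebraMap_polynomial]
  simp

/-! ### Extensions of `ℂ(x)` containing a square root of `1 - x²` -/

section Extension

variable {L : Type*} [Field L] [Algebra (RatFunc ℂ) L]

/-- A polynomial, as an element of an extension of `ℂ(x)`. -/
def polyMap (L : Type*) [Field L] [Algebra (RatFunc ℂ) L] : ℂ[X] →+* L :=
  (algebraMap (RatFunc ℂ) L).comp (algebraMap ℂ[X] (RatFunc ℂ))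

theorem polyMap_injective : Function.Injective (polyMap L) :=
  (algebraMap (RatFunc ℂ) L).injective.comp (RatFunc.algebraMap_injective ℂ)

theorem polyMap_mem (F : IntermediateField (RatFunc ℂ) L) (p : ℂ[X]) : polyMap L p ∈ F :=
  F.algebraMap_mem _

theorem polyMap_one_sub_X_sq : polyMap L (1 - X ^ 2) = 1 - polyMap L X ^ 2 := by
  simp

theorem one_sub_polyMap_X_sq_ne_zero : 1 - polyMap L X ^ 2 ≠ 0 := by
  rw [← polyMap_one_sub_X_sq, map_ne_zero_iff _ polyMap_injective]
  intro h
  have := congrArg (eval 0) h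
  simp at this

theorem polyMap_pell (n : ℕ) :
    polyMap L (Chebyshev.T ℂ (n : ℤ)) ^ 2
      + (1 - polyMap L X ^ 2) * polyMap L (Chebyshev.U ℂ ((n : ℤ) - 1)) ^ 2 = 1 := by
  simpa only [map_add, map_mul, map_pow, map_sub, map_one] using
    congrArg (polyMap L) (chebyshev_pell n)

theorem polyMap_T_ne_zero (n : ℕ) : polyMap L (Chebyshev.T ℂ (n : ℤ)) ≠ 0 :=
  (map_ne_zero_iff _ polyMap_injective).mpr (chebyshevT_ne_zero n)

theorem finrank_eq_two {s : L} (hs : s ^ 2 = 1 - polyMap L X ^ 2)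
    (htop : IntermediateField.adjoin (RatFunc ℂ) {s} = ⊤) :
    Module.finrank (RatFunc ℂ) L = 2 := by
  have hq : algebraMap (RatFunc ℂ) L (1 - RatFunc.X ^ 2) = 1 - polyMap L X ^ 2 := by
    rw [← polyMap_one_sub_X_sq, one_sub_X_sq_eq]; rfl
  have hirr := X_pow_sub_C_irreducible_of_prime Nat.prime_two sq_ne_one_sub_X_sq
  have hmon : (X ^ 2 - C (1 - RatFunc.X ^ 2) : (RatFunc ℂ)[X]).Monic :=
    monic_X_pow_sub_C _ two_ne_zero
  have hroot : aeval s (X ^ 2 - C (1 - RatFunc.X ^ 2) : (RatFunc ℂ)[X]) = 0 := by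
    simp only [map_sub, map_pow, aeval_X, aeval_C, hs] at hq ⊢
    rw [hq, sub_self]
  have hmin := minpoly.eq_of_irreducible_of_monic hirr hroot hmon
  have hint : IsIntegral (RatFunc ℂ) s := ⟨_, hmon, hroot⟩
  rw [← IntermediateField.finrank_top', ← htop, IntermediateField.adjoin.finrank hint, ← hmin,
    natDegree_X_pow_sub_C]

theorem exists_eq_add_mul {s : L} (hs : s ^ 2 = 1 - polyMap L X ^ 2)
    (htop : IntermediateField.adjoin (RatFunc ℂ) {s} = ⊤) (y : L) :
    ∃ a b : RatFunc ℂ, y = algebraMap _ L a + algebraMap _ L b * s := by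
  have hfin : FiniteDimensional (RatFunc ℂ) L :=
    FiniteDimensional.of_finrank_pos (by rw [finrank_eq_two hs htop]; exact two_pos)
  have hq : algebraMap (RatFunc ℂ) L (1 - RatFunc.X ^ 2) = s ^ 2 := by
    rw [hs, ← polyMap_one_sub_X_sq, one_sub_X_sq_eq]; rfl
  have hy : y ∈ Algebra.adjoin (RatFunc ℂ) {s} := by
    rw [← IntermediateField.adjoin_simple_toSubalgebra_of_isAlgebraic (IsAlgebraic.of_finite _ s),
      htop]
    trivial
  induction hy using Algebra.adjoin_induction with
  | mem z hz => exact ⟨0, 1, by rw [Set.mem_singleton_iff.mp hz]; simp⟩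
  | algebraMap r => exact ⟨r, 0, by simp⟩
  | add y z _ _ hy hz =>
    obtain ⟨a, b, rfl⟩ := hy
    obtain ⟨c, d, rfl⟩ := hz
    exact ⟨a + c, b + d, by rw [map_add, map_add]; ring⟩
  | mul y z _ _ hy hz =>
    obtain ⟨a, b, rfl⟩ := hy
    obtain ⟨c, d, rfl⟩ := hz
    refine ⟨a * c + b * d * (1 - RatFunc.X ^ 2), a * d + b * c, ?_⟩
    rw [map_add, map_add, map_mul, map_mul, map_mul, map_mul, map_mul, hq]
    ring

/-! ### The Chebyshev equation in a differential extension -/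

variable [Differential L]

theorem isSolution_iff (n : ℕ) (y : L) :
    IsSolution chebA (chebB n) y ↔
      (1 - polyMap L X ^ 2) * y′′ - polyMap L X * y′ + (n : L) ^ 2 * y = 0 := by
  have hq := one_sub_polyMap_X_sq_ne_zero (L := L)
  have hX : algebraMap (RatFunc ℂ) L RatFunc.X = polyMap L X := by
    rw [← RatFunc.algebraMap_X]; rfl
  rw [IsSolution, chebA, chebB]
  simp only [map_neg, map_div₀, map_sub, map_one, map_pow, map_natCast, hX]
  rw [← mul_right_inj' hq, mul_zero]
  apply Eq.congr_left
  field_simp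
  ring

/-- The Wronskian of two solutions of the Chebyshev equation. -/
theorem deriv_wronskian {n : ℕ} {y z : L} (hy : IsSolution chebA (chebB n) y)
    (hz : IsSolution chebA (chebB n) z) :
    (1 - polyMap L X ^ 2) * (y * z′ - y′ * z)′ = polyMap L X * (y * z′ - y′ * z) := by
  rw [isSolution_iff] at hy hz
  simp only [map_sub, Derivation.leibniz, smul_eq_mul]
  linear_combination y * hz - z * hy

variable [DifferentialAlgebra (RatFunc ℂ) L]

theorem deriv_polyMap (p : ℂ[X]) : (polyMap L p)′ = polyMap L (derivative p) := by
  change (algebraMap (RatFunc ℂ) L _)′ = algebraMap (RatFunc ℂ) L _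
  rw [deriv_algebraMap, deriv_algebraMap_polynomial]

theorem deriv_polyMap_T (n : ℕ) : (polyMap L (Chebyshev.T ℂ (n : ℤ)))′ =
    n * polyMap L (Chebyshev.U ℂ ((n : ℤ) - 1)) := by
  rw [deriv_polyMap, derivative_chebyshevT, map_mul, map_natCast]

theorem deriv_polyMap_U (n : ℕ) :
    (1 - polyMap L X ^ 2) * (polyMap L (Chebyshev.U ℂ ((n : ℤ) - 1)))′ =
      polyMap L X * polyMap L (Chebyshev.U ℂ ((n : ℤ) - 1))
        - n * polyMap L (Chebyshev.T ℂ (n : ℤ)) := by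
  rw [deriv_polyMap, ← polyMap_one_sub_X_sq, ← map_mul, one_sub_X_sq_mul_derivative_chebyshevU]
  simp

theorem deriv_polyMap_X : (polyMap L X)′ = 1 := by
  rw [deriv_polyMap]; simp

theorem deriv_one_sub_polyMap_X_sq : (1 - polyMap L X ^ 2)′ = -2 * polyMap L X := by
  simp [sq, deriv_polyMap_X]
  ring

/-- The logarithmic derivative of a square root of `1 - x²` is `-x / (1 - x²)`. -/
theorem deriv_sqrt {s : L} (hs : s ^ 2 = 1 - polyMap L X ^ 2) :
    (1 - polyMap L X ^ 2) * s′ = -polyMap L X * s := by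
  have : CharZero L := charZero_of_injective_algebraMap (algebraMap (RatFunc ℂ) L).injective
  have h := congrArg (fun z : L => z′) hs
  simp only [deriv_one_sub_polyMap_X_sq, sq s, Derivation.leibniz, smul_eq_mul] at h
  have h2 : s * s′ = -polyMap L X := by
    apply mul_left_cancel₀ (two_ne_zero (α := L))
    linear_combination h
  rw [← hs]
  linear_combination s * h2

theorem isSolution_T (n : ℕ) :
    IsSolution chebA (chebB n) (polyMap L (Chebyshev.T ℂ (n : ℤ))) := by
  rw [isSolution_iff, deriv_polyMap_T, Derivation.leibniz, Derivation.map_natCast]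
  simp only [smul_eq_mul]
  linear_combination (n : L) * deriv_polyMap_U (L := L) n

theorem deriv_U_mul_sqrt (n : ℕ) {s : L} (hs : s ^ 2 = 1 - polyMap L X ^ 2) :
    (1 - polyMap L X ^ 2) * (polyMap L (Chebyshev.U ℂ ((n : ℤ) - 1)) * s)′ =
      -n * polyMap L (Chebyshev.T ℂ (n : ℤ)) * s := by
  rw [Derivation.leibniz]
  simp only [smul_eq_mul]
  linear_combination s * deriv_polyMap_U (L := L) n
    + polyMap L (Chebyshev.U ℂ ((n : ℤ) - 1)) * deriv_sqrt hs

theorem isSolution_U_mul_sqrt (n : ℕ) {s : L} (hs : s ^ 2 = 1 - polyMap L X ^ 2) :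
    IsSolution chebA (chebB n) (polyMap L (Chebyshev.U ℂ ((n : ℤ) - 1)) * s) := by
  rw [isSolution_iff]
  have hq := one_sub_polyMap_X_sq_ne_zero (L := L)
  have h1 := deriv_U_mul_sqrt n hs
  -- Only `(1-x²) Y'` has a simple form, so that product is differentiated; one more factor `1-x²`
  -- then clears `s'`.
  have h2 := congrArg (fun z : L => z′) h1
  simp only [Derivation.leibniz, deriv_one_sub_polyMap_X_sq, deriv_polyMap_T, Derivation.map_natCast,
    smul_eq_mul, map_neg] at h2
  apply mul_left_cancel₀ hq
  simp only [Derivation.leibniz, smul_eq_mul] at h1 h2 ⊢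
  linear_combination (1 - polyMap L X ^ 2) * h2 + polyMap L X * h1 -
    n * polyMap L (Chebyshev.T ℂ (n : ℤ)) * deriv_sqrt hs

/-- The logarithmic derivatives of the Wronskian and of `s` are opposite: `x/(1-x²)` and
`-x/(1-x²)`. -/
theorem deriv_wronskian_mul_sqrt {n : ℕ} {y z s : L} (hy : IsSolution chebA (chebB n) y)
    (hz : IsSolution chebA (chebB n) z) (hs : s ^ 2 = 1 - polyMap L X ^ 2) :
    ((y * z′ - y′ * z) * s)′ = 0 := by
  apply mul_left_cancel₀ (one_sub_polyMap_X_sq_ne_zero (L := L))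
  rw [Derivation.leibniz]
  simp only [smul_eq_mul]
  linear_combination s * deriv_wronskian hy hz + (y * z′ - y′ * z) * deriv_sqrt hs

/-- The left side is `-n s (T² + (1-x²) U²)`, which the Pell identity collapses. -/
theorem wronskian_T_U (n : ℕ) {s : L} (hs : s ^ 2 = 1 - polyMap L X ^ 2) :
    (1 - polyMap L X ^ 2) * (polyMap L (Chebyshev.T ℂ (n : ℤ))
        * (polyMap L (Chebyshev.U ℂ ((n : ℤ) - 1)) * s)′
      - (polyMap L (Chebyshev.T ℂ (n : ℤ)))′
        * (polyMap L (Chebyshev.U ℂ ((n : ℤ) - 1)) * s)) = -n * s := by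
  rw [deriv_polyMap_T]
  linear_combination polyMap L (Chebyshev.T ℂ (n : ℤ)) * deriv_U_mul_sqrt n hs
    - n * s * polyMap_pell (L := L) n

/-- A Picard–Vessiot extension contains a solution independent of `T_n`. -/
theorem IsPicardVessiot.exists_wronskian_ne_zero {n : ℕ}
    (h : IsPicardVessiot L chebA (chebB n)) :
    ∃ z : L, IsSolution chebA (chebB n) z ∧
      polyMap L (Chebyshev.T ℂ (n : ℤ)) * z′ - (polyMap L (Chebyshev.T ℂ (n : ℤ)))′ * z ≠ 0 := by
  obtain ⟨y, z, hy, hz, hind, -⟩ := h.generated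
  set t := polyMap L (Chebyshev.T ℂ (n : ℤ)) with ht
  have ht0 : t ≠ 0 := polyMap_T_ne_zero n
  have hconst : ∀ y : L, t * y′ - t′ * y = 0 → (y / t)′ = 0 := by
    intro y hy
    rw [Derivation.leibniz_div]
    simp only [smul_eq_mul]
    rw [mul_comm y, hy, mul_zero]
  by_contra! hcon
  have hy0 := hconst y (hcon y hy)
  have hz0 := hconst z (hcon z hz)
  have hyt : y / t = 0 := by
    -- If both quotients by `T_n` are constant, `(z/t) y - (y/t) z = 0` is a linear relation over
    -- the constants.
    have := (hind (z / t) (-(y / t)) hz0 (by rw [map_neg, hy0, neg_zero]) (by ring)).2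
    simpa using this
  have hyz : y = 0 := by simpa [ht0] using hyt
  have := (hind 1 0 (by simp) (by simp) (by rw [hyz]; ring)).1
  exact one_ne_zero this

/-- The constant `(1-x²) w²` is nonzero and equals `e²` with `e ∈ ℂ`, so `(1-x²) w / e` is the
required root. -/
theorem IsPicardVessiot.exists_sqrt {n : ℕ} (h : IsPicardVessiot L chebA (chebB n)) :
    ∃ s : L, s ^ 2 = 1 - polyMap L X ^ 2 := by
  obtain ⟨z, hz, hw⟩ := h.exists_wronskian_ne_zero
  have hD := deriv_wronskian (isSolution_T n) hz
  set w := polyMap L (Chebyshev.T ℂ (n : ℤ)) * z′ - (polyMap L (Chebyshev.T ℂ (n : ℤ)))′ * z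
  have hq := one_sub_polyMap_X_sq_ne_zero (L := L)
  have hk : ((1 - polyMap L X ^ 2) * w ^ 2)′ = 0 := by
    rw [Derivation.leibniz, deriv_one_sub_polyMap_X_sq, sq w, Derivation.leibniz]
    simp only [smul_eq_mul]
    linear_combination 2 * w * hD
  obtain ⟨d, hd, hdk⟩ := h.no_new_constants _ hk
  obtain ⟨c, rfl⟩ := eq_C_of_deriv_eq_zero hd
  obtain ⟨e, he⟩ := IsAlgClosed.exists_pow_nat_eq c two_pos
  have heL : algebraMap (RatFunc ℂ) L (RatFunc.C e) ^ 2 = (1 - polyMap L X ^ 2) * w ^ 2 := by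
    rw [← map_pow, ← map_pow, he, hdk]
  have he0 : algebraMap (RatFunc ℂ) L (RatFunc.C e) ≠ 0 := by
    intro h0
    rw [h0, zero_pow two_ne_zero] at heL
    exact mul_ne_zero hq (pow_ne_zero 2 hw) heL.symm
  refine ⟨(1 - polyMap L X ^ 2) * w / algebraMap (RatFunc ℂ) L (RatFunc.C e), ?_⟩
  rw [div_pow, heL]
  field_simp

theorem mem_adjoin_sqrt {n : ℕ} (hn : 1 ≤ n)
    (hc : ∀ c : L, c′ = 0 → ∃ d : RatFunc ℂ, d′ = 0 ∧ algebraMap (RatFunc ℂ) L d = c)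
    {s : L} (hs : s ^ 2 = 1 - polyMap L X ^ 2) {z : L} (hz : IsSolution chebA (chebB n) z) :
    z ∈ IntermediateField.adjoin (RatFunc ℂ) {s} ∧
      z′ ∈ IntermediateField.adjoin (RatFunc ℂ) {s} := by
  have : CharZero L := charZero_of_injective_algebraMap (algebraMap (RatFunc ℂ) L).injective
  have hn0 : (n : L) ≠ 0 := Nat.cast_ne_zero.mpr (by omega)
  have hq := one_sub_polyMap_X_sq_ne_zero (L := L)
  set F := IntermediateField.adjoin (RatFunc ℂ) {s}
  have hsF : s ∈ F := IntermediateField.mem_adjoin_simple_self _ s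
  have hs0 : s ≠ 0 := by
    rintro rfl
    exact hq (by rw [← hs, zero_pow two_ne_zero])
  have hW := wronskian_T_U n hs
  have hY' := deriv_U_mul_sqrt n hs
  have hT' := deriv_polyMap_T (L := L) n
  obtain ⟨d₁, -, h₁⟩ := hc _ (deriv_wronskian_mul_sqrt (isSolution_T n) hz hs)
  obtain ⟨d₂, -, h₂⟩ := hc _ (deriv_wronskian_mul_sqrt (isSolution_U_mul_sqrt n hs) hz hs)
  have htF := polyMap_mem F (Chebyshev.T ℂ (n : ℤ))
  have huF := polyMap_mem F (Chebyshev.U ℂ ((n : ℤ) - 1))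
  have hqF := polyMap_mem F (1 - X ^ 2)
  rw [polyMap_one_sub_X_sq] at hqF
  have hd₁ : algebraMap _ L d₁ ∈ F := F.algebraMap_mem _
  have hd₂ : algebraMap _ L d₂ ∈ F := F.algebraMap_mem _
  have hnF : (n : L) ∈ F := natCast_mem F n
  set t := polyMap L (Chebyshev.T ℂ (n : ℤ))
  set Y := polyMap L (Chebyshev.U ℂ ((n : ℤ) - 1)) * s with hY
  have hYF : Y ∈ F := mul_mem huF hsF
  have hY'F : Y′ ∈ F := by
    have : Y′ = -n * t * s / (1 - polyMap L X ^ 2) := by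
      rw [eq_div_iff hq, mul_comm]; exact hY'
    rw [this]
    exact div_mem (mul_mem (mul_mem (neg_mem hnF) htF) hsF) hqF
  have hT'F : t′ ∈ F := by rw [hT']; exact mul_mem hnF huF
  -- Cramer's rule: `z W(T,Y) = Y W(T,z) - T W(Y,z)`, multiplied by `s`. Here `s W(T,Y) = -n`, and
  -- `d₁`, `d₂` are `s W(T,z)`, `s W(Y,z)`. The same formula holds with `z`, `T`, `Y` replaced by
  -- their derivatives.
  have hz1 : z = (t * algebraMap _ L d₂ - Y * algebraMap _ L d₁) / n := by
    rw [eq_div_iff hn0]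
    apply mul_left_cancel₀ (mul_ne_zero hs0 hs0)
    rw [h₁, h₂]
    linear_combination (z * s) * hW + (t * Y′ - t′ * Y) * z * s * hs
  have hz2 : z′ = (t′ * algebraMap _ L d₂ - Y′ * algebraMap _ L d₁) / n := by
    rw [eq_div_iff hn0]
    apply mul_left_cancel₀ (mul_ne_zero hs0 hs0)
    rw [h₁, h₂]
    linear_combination (z′ * s) * hW + (t * Y′ - t′ * Y) * z′ * s * hs
  rw [hz2]
  refine ⟨?_, div_mem (sub_mem (mul_mem hT'F hd₂) (mul_mem hY'F hd₁)) hnF⟩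
  rw [hz1]
  exact div_mem (sub_mem (mul_mem htF hd₂) (mul_mem hYF hd₁)) hnF

theorem IsPicardVessiot.adjoin_sqrt_eq_top {n : ℕ} (hn : 1 ≤ n)
    (h : IsPicardVessiot L chebA (chebB n)) {s : L} (hs : s ^ 2 = 1 - polyMap L X ^ 2) :
    IntermediateField.adjoin (RatFunc ℂ) {s} = ⊤ := by
  obtain ⟨y, z, hy, hz, -, htop⟩ := h.generated
  obtain ⟨hy1, hy2⟩ := mem_adjoin_sqrt hn h.no_new_constants hs hy
  obtain ⟨hz1, hz2⟩ := mem_adjoin_sqrt hn h.no_new_constants hs hz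
  rw [eq_top_iff, ← htop, IntermediateField.adjoin_le_iff]
  rintro v (rfl | rfl | rfl | rfl) <;> assumption

/-- A derivation extends uniquely to an algebraic extension in characteristic zero, so every
`ℂ(x)`-automorphism is differential. The group is the full Galois group of a quadratic extension. -/
theorem nonempty_diffGaloisGroup_mulEquiv {s : L} (hs : s ^ 2 = 1 - polyMap L X ^ 2)
    (htop : IntermediateField.adjoin (RatFunc ℂ) {s} = ⊤) :
    Nonempty (diffGaloisGroup (RatFunc ℂ) L ≃* Multiplicative (ZMod 2)) := by
  have hquad : Algebra.IsQuadraticExtension (RatFunc ℂ) L := ⟨finrank_eq_two hs htop⟩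
  have hG : diffGaloisGroup (RatFunc ℂ) L = ⊤ :=
    eq_top_iff.mpr fun σ _ y => Differential.algEquiv_deriv' σ y
  have hcard : Nat.card (diffGaloisGroup (RatFunc ℂ) L) = 2 := by
    rw [hG, Subgroup.card_top, IsGalois.card_aut_eq_finrank, finrank_eq_two hs htop]
  exact ⟨mulEquivOfPrimeCardEq (p := 2) hcard (by simp)⟩

/-- The extension `ℂ(x, √(1 - x²))` has no new constants. -/
theorem exists_const_of_deriv_eq_zero {s : L} (hs : s ^ 2 = 1 - polyMap L X ^ 2)
    (htop : IntermediateField.adjoin (RatFunc ℂ) {s} = ⊤) {c : L} (hc : c′ = 0) :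
    ∃ d : RatFunc ℂ, d′ = 0 ∧ algebraMap (RatFunc ℂ) L d = c := by
  obtain ⟨a, b, rfl⟩ := exists_eq_add_mul hs htop c
  have hX : algebraMap (RatFunc ℂ) L RatFunc.X = polyMap L X := by
    rw [← RatFunc.algebraMap_X]; rfl
  have hqL := one_sub_polyMap_X_sq_ne_zero (L := L)
  have hs' := deriv_sqrt hs
  rw [map_add, Derivation.leibniz, deriv_algebraMap, deriv_algebraMap] at hc
  simp only [smul_eq_mul] at hc
  have key : algebraMap (RatFunc ℂ) L ((1 - RatFunc.X ^ 2) * a′)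
      + algebraMap (RatFunc ℂ) L ((1 - RatFunc.X ^ 2) * b′ - RatFunc.X * b) * s = 0 := by
    simp only [map_mul, map_sub, map_one, map_pow, hX]
    linear_combination (1 - polyMap L X ^ 2) * hc - algebraMap _ L b * hs'
  -- Otherwise `key` could be solved for `s`, making `1-x²` a square in `ℂ(x)`.
  have hB : (1 - RatFunc.X ^ 2) * b′ - RatFunc.X * b = 0 := by
    by_contra hne
    have hne' : algebraMap (RatFunc ℂ) L ((1 - RatFunc.X ^ 2) * b′ - RatFunc.X * b) ≠ 0 :=
      (_root_.map_ne_zero _).mpr hne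
    apply sq_ne_one_sub_X_sq
      (-((1 - RatFunc.X ^ 2) * a′) / ((1 - RatFunc.X ^ 2) * b′ - RatFunc.X * b))
    apply (algebraMap (RatFunc ℂ) L).injective
    rw [map_pow, map_div₀, map_neg, map_sub (algebraMap (RatFunc ℂ) L) 1, map_pow, map_one, hX,
      ← hs]
    congr 1
    rw [div_eq_iff hne']
    linear_combination -key
  rw [hB, map_zero, zero_mul, add_zero, map_eq_zero, mul_eq_zero,
    or_iff_right one_sub_X_sq_ne_zero] at key
  -- Otherwise `(1-x²) b²` is a constant `e²`, and `e / b` is a square root of `1-x²` in `ℂ(x)`.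
  have hb : b = 0 := by
    by_contra hb
    have hk : ((1 - RatFunc.X ^ 2) * b ^ 2)′ = 0 := by
      simp only [sq, Derivation.leibniz, map_sub, Derivation.map_one_eq_zero, deriv_X, smul_eq_mul]
      linear_combination 2 * b * hB
    obtain ⟨k, hk⟩ := eq_C_of_deriv_eq_zero hk
    obtain ⟨e, he⟩ := IsAlgClosed.exists_pow_nat_eq k two_pos
    apply sq_ne_one_sub_X_sq (RatFunc.C e / b)
    rw [div_pow, ← map_pow, he, ← hk]
    field_simp
  exact ⟨a, key, by simp [hb]⟩

theorem isPicardVessiot_of_sqrt {n : ℕ} (hn : 1 ≤ n) {s : L}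
    (hs : s ^ 2 = 1 - polyMap L X ^ 2)
    (htop : IntermediateField.adjoin (RatFunc ℂ) {s} = ⊤) :
    IsPicardVessiot L chebA (chebB n) where
  no_new_constants _ hc := exists_const_of_deriv_eq_zero hs htop hc
  generated := by
    have : CharZero L := charZero_of_injective_algebraMap (algebraMap (RatFunc ℂ) L).injective
    have hn0 : (n : L) ≠ 0 := Nat.cast_ne_zero.mpr (by omega)
    have hs0 : s ≠ 0 := by
      rintro rfl
      exact one_sub_polyMap_X_sq_ne_zero (L := L) (by rw [← hs, zero_pow two_ne_zero])
    have hu0 : polyMap L (Chebyshev.U ℂ ((n : ℤ) - 1)) ≠ 0 :=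
      (map_ne_zero_iff _ polyMap_injective).mpr (chebyshevU_ne_zero hn)
    have hW := wronskian_T_U n hs
    have hW0 : polyMap L (Chebyshev.T ℂ (n : ℤ))
        * (polyMap L (Chebyshev.U ℂ ((n : ℤ) - 1)) * s)′
      - (polyMap L (Chebyshev.T ℂ (n : ℤ)))′
        * (polyMap L (Chebyshev.U ℂ ((n : ℤ) - 1)) * s) ≠ 0 := by
      intro h0
      rw [h0, mul_zero] at hW
      exact mul_ne_zero (neg_ne_zero.mpr hn0) hs0 hW.symm
    refine ⟨_, _, isSolution_T n, isSolution_U_mul_sqrt n hs, ?_, ?_⟩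
    · intro c₁ c₂ h₁ h₂ h
      have hd := congrArg (fun z : L => z′) h
      rw [map_add, Derivation.leibniz, Derivation.leibniz _ c₂, h₁, h₂] at hd
      simp only [smul_eq_mul, mul_zero, add_zero, map_zero] at hd
      constructor
      · refine (mul_eq_zero.mp ?_).resolve_right hW0
        linear_combination (polyMap L (Chebyshev.U ℂ ((n : ℤ) - 1)) * s)′ * h
          - (polyMap L (Chebyshev.U ℂ ((n : ℤ) - 1)) * s) * hd
      · refine (mul_eq_zero.mp ?_).resolve_right hW0
        linear_combination polyMap L (Chebyshev.T ℂ (n : ℤ)) * hd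
          - (polyMap L (Chebyshev.T ℂ (n : ℤ)))′ * h
    · rw [eq_top_iff, ← htop, IntermediateField.adjoin_simple_le_iff]
      set F := IntermediateField.adjoin (RatFunc ℂ)
        {polyMap L (Chebyshev.T ℂ (n : ℤ)), polyMap L (Chebyshev.U ℂ ((n : ℤ) - 1)) * s,
          (polyMap L (Chebyshev.T ℂ (n : ℤ)))′, (polyMap L (Chebyshev.U ℂ ((n : ℤ) - 1)) * s)′}
      have hmem : polyMap L (Chebyshev.U ℂ ((n : ℤ) - 1)) * s ∈ F :=
        IntermediateField.subset_adjoin _ _ (by simp)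
      have := div_mem hmem (polyMap_mem F (Chebyshev.U ℂ ((n : ℤ) - 1)))
      rwa [mul_div_cancel_left₀ _ hu0] at this

end Extension

theorem exists_isPicardVessiot {n : ℕ} (hn : 1 ≤ n) :
    ∃ (L : Type) (_ : Field L) (_ : Differential L) (_ : Algebra (RatFunc ℂ) L)
      (_ : DifferentialAlgebra (RatFunc ℂ) L), IsPicardVessiot L chebA (chebB n) := by
  let p : (RatFunc ℂ)[X] := X ^ 2 - C (1 - RatFunc.X ^ 2)
  -- The two `Fact`s supply the field and differential structures on `AdjoinRoot p`.
  have hirr : Fact (Irreducible p) :=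
    ⟨X_pow_sub_C_irreducible_of_prime Nat.prime_two sq_ne_one_sub_X_sq⟩
  have hmon : Fact p.Monic := ⟨monic_X_pow_sub_C _ two_ne_zero⟩
  have hs : AdjoinRoot.root p ^ 2 = 1 - polyMap (AdjoinRoot p) X ^ 2 := by
    have h := AdjoinRoot.aeval_eq (f := p) p
    rw [AdjoinRoot.mk_self] at h
    simp only [p, map_sub, map_pow, aeval_X, aeval_C] at h
    rw [sub_eq_zero] at h
    simpa [polyMap, p] using h
  exact ⟨AdjoinRoot p, inferInstance, inferInstance, inferInstance, inferInstance,
    isPicardVessiot_of_sqrt hn hs (IntermediateField.adjoin_root_eq_top p)⟩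

/-! ### First integrals -/

/-- A family of Möbius transformations in the first variable, with coefficients depending on the
second one, is a first integral of any vector field along which its derivative vanishes. -/
theorem isFirstIntegral_of_moebius {V : ℂ × ℂ → ℂ × ℂ} {D : Set (ℂ × ℂ)} {I : ℂ × ℂ → ℂ}
    {a b c e da db dc de : ℂ → ℂ} (hopen : IsOpen D) (hne : D.Nonempty)
    (ha : ∀ p ∈ D, HasDerivAt a (da p.2) p.2) (hb : ∀ p ∈ D, HasDerivAt b (db p.2) p.2)
    (hc : ∀ p ∈ D, HasDerivAt c (dc p.2) p.2) (he : ∀ p ∈ D, HasDerivAt e (de p.2) p.2)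
    (hden : ∀ p ∈ D, c p.2 * p.1 + e p.2 ≠ 0)
    (hdet : ∀ p ∈ D, a p.2 * e p.2 - b p.2 * c p.2 ≠ 0)
    (hI : ∀ p ∈ D, I p = (a p.2 * p.1 + b p.2) / (c p.2 * p.1 + e p.2))
    (hV : ∀ p ∈ D, (V p).2 * ((da p.2 * p.1 + db p.2) * (c p.2 * p.1 + e p.2)
        - (a p.2 * p.1 + b p.2) * (dc p.2 * p.1 + de p.2))
      + (V p).1 * (a p.2 * e p.2 - b p.2 * c p.2) = 0) :
    IsFirstIntegral V D I := by
  have hev : ∀ p ∈ D, I =ᶠ[nhds p]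
      fun p => (a p.2 * p.1 + b p.2) / (c p.2 * p.1 + e p.2) := fun p hp =>
    Filter.eventuallyEq_of_mem (hopen.mem_nhds hp) hI
  have hdiff : ∀ p ∈ D, DifferentiableAt ℂ
      (fun p : ℂ × ℂ => (a p.2 * p.1 + b p.2) / (c p.2 * p.1 + e p.2)) p := by
    intro p hp
    have hs : ∀ {f : ℂ → ℂ} {df : ℂ}, HasDerivAt f df p.2 →
        DifferentiableAt ℂ (fun p : ℂ × ℂ => f p.2) p := fun hf =>
      hf.differentiableAt.comp p differentiableAt_snd
    have hnum := ((hs (ha p hp)).fun_mul differentiableAt_fst).fun_add (hs (hb p hp))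
    have hdenom := ((hs (hc p hp)).fun_mul differentiableAt_fst).fun_add (hs (he p hp))
    simp only [div_eq_mul_inv]
    exact hnum.fun_mul (hdenom.fun_inv (hden p hp))
  refine ⟨hopen, hne, fun p hp =>
    ((hev p hp).differentiableAt_iff.mpr (hdiff p hp)).differentiableWithinAt, ?_, ?_⟩
  · intro p hp
    rw [(hev p hp).fderiv_eq]
    -- The derivative along `V` is computed on the line `t ↦ p + t V(p)`, where the one-variable
    -- quotient rule applies.
    have hx : HasDerivAt (fun t : ℂ => p.2 + t * (V p).2) (V p).2 0 := by
      simpa using ((hasDerivAt_id (0 : ℂ)).mul_const (V p).2).const_add p.2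
    have hv : HasDerivAt (fun t : ℂ => p.1 + t * (V p).1) (V p).1 0 := by
      simpa using ((hasDerivAt_id (0 : ℂ)).mul_const (V p).1).const_add p.1
    have hcomp : ∀ {f : ℂ → ℂ} {df : ℂ}, HasDerivAt f df p.2 →
        HasDerivAt (fun t : ℂ => f (p.2 + t * (V p).2)) (df * (V p).2) 0 := fun hf =>
      HasDerivAt.comp_of_eq 0 hf hx (by simp)
    have hline : HasDerivAt (fun t : ℂ => (p.1 + t * (V p).1, p.2 + t * (V p).2)) (V p) 0 :=
      hv.prodMk hx
    have h1 := HasFDerivAt.comp_hasDerivAt_of_eq (0 : ℂ) (hdiff p hp).hasFDerivAt hline (by simp)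
    have h2 := (((hcomp (ha p hp)).mul hv).add (hcomp (hb p hp))).div
      (((hcomp (hc p hp)).mul hv).add (hcomp (he p hp))) (by simpa using hden p hp)
    refine (h1.unique h2).trans ?_
    simp only [Pi.add_apply, Pi.mul_apply, zero_mul, add_zero]
    rw [div_eq_zero_iff]
    left
    linear_combination hV p hp
  · rintro W hW ⟨p, hp⟩ hWD ⟨k, hk⟩
    -- Only the first coordinate is moved: a Möbius map of nonzero determinant is injective.
    have hnhds : ∀ᶠ v in nhdsWithin p.1 {p.1}ᶜ, (v, p.2) ∈ W := by
      apply Filter.Eventually.filter_mono nhdsWithin_le_nhds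
      exact (Continuous.prodMk_left p.2).continuousAt.eventually_mem (hW.mem_nhds hp)
    obtain ⟨v, hvW, hvne⟩ := (hnhds.and self_mem_nhdsWithin).exists
    have h := (hk _ hvW).trans (hk p hp).symm
    rw [hI _ (hWD hvW), hI _ (hWD hp), div_eq_div_iff (hden _ (hWD hvW)) (hden _ (hWD hp))] at h
    refine mul_ne_zero (sub_ne_zero.mpr hvne) (hdet p (hWD hp)) ?_
    simp only at h
    linear_combination h

/-! ### Branches of `√(1-x²)` and derivatives of Chebyshev functions -/

section Branch

variable {Ω : Set ℂ} {s : ℂ → ℂ}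

theorem IsSqrtBranch.sq_deriv (h : IsSqrtBranch Ω s) {x : ℂ} (hx : x ∈ Ω) :
    s x * deriv s x = -x := by
  have hd : HasDerivAt s (deriv s x) x :=
    (h.differentiableOn.differentiableAt (h.isOpen.mem_nhds hx)).hasDerivAt
  have h1 : HasDerivAt (fun y => 1 - y ^ 2) (2 * s x * deriv s x) x := by
    have := (hd.pow 2).congr_of_eventuallyEq (f₁ := fun y => 1 - y ^ 2)
      (Filter.eventuallyEq_of_mem (h.isOpen.mem_nhds hx) fun y hy => (h.sq_eq y hy).symm)
    simpa using this
  have h2 : HasDerivAt (fun y : ℂ => 1 - y ^ 2) (-(2 * x)) x := by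
    simpa using (hasDerivAt_pow 2 x).const_sub 1
  linear_combination (1 / 2 : ℂ) * h1.unique h2

/-- No holomorphic branch exists at `±1`: differentiating the square gives `s s' = -x`, so `s = 0`
forces `x = 0`, where `s² = 1`. -/
theorem IsSqrtBranch.ne_zero (h : IsSqrtBranch Ω s) {x : ℂ} (hx : x ∈ Ω) : s x ≠ 0 := by
  intro h0
  have h1 := h.sq_deriv hx
  have h2 := h.sq_eq x hx
  rw [h0, zero_mul] at h1
  rw [h0, neg_eq_zero.mp h1.symm] at h2
  norm_num at h2

theorem IsSqrtBranch.one_sub_sq_ne_zero (h : IsSqrtBranch Ω s) {x : ℂ} (hx : x ∈ Ω) :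
    1 - x ^ 2 ≠ 0 := by
  rw [← h.sq_eq x hx]
  exact pow_ne_zero 2 (h.ne_zero hx)

theorem IsSqrtBranch.hasDerivAt (h : IsSqrtBranch Ω s) {x : ℂ} (hx : x ∈ Ω) :
    HasDerivAt s (-x * s x / (1 - x ^ 2)) x := by
  have hd : HasDerivAt s (deriv s x) x :=
    (h.differentiableOn.differentiableAt (h.isOpen.mem_nhds hx)).hasDerivAt
  convert hd using 1
  rw [div_eq_iff (h.one_sub_sq_ne_zero hx), ← h.sq_eq x hx]
  linear_combination -s x * h.sq_deriv hx

/-- A nonzero polynomial does not vanish identically on a nonempty open set. -/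
theorem exists_mem_eval_ne_zero (hopen : IsOpen Ω) (hne : Ω.Nonempty) {p : ℂ[X]} (hp : p ≠ 0) :
    ∃ x ∈ Ω, p.eval x ≠ 0 := by
  by_contra! hcon
  obtain ⟨x, hx⟩ := hne
  exact hp (p.eq_zero_of_infinite_isRoot
    ((infinite_of_mem_nhds x (hopen.mem_nhds hx)).mono hcon))

end Branch

theorem chebT'_eq (n : ℕ) (x : ℂ) : chebT' n x = n * chebU n x := by
  simp [chebT', chebU, derivative_chebyshevT]

theorem one_sub_sq_mul_chebU' (n : ℕ) (x : ℂ) :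
    (1 - x ^ 2) * chebU' n x = x * chebU n x - n * chebT n x := by
  simpa [chebU', chebT, chebU] using
    congrArg (eval x) (one_sub_X_sq_mul_derivative_chebyshevU n)

theorem cheb_pell (n : ℕ) (x : ℂ) : chebT n x ^ 2 + (1 - x ^ 2) * chebU n x ^ 2 = 1 := by
  simpa [chebT, chebU] using congrArg (eval x) (chebyshev_pell n)

theorem hasDerivAt_chebT (n : ℕ) (x : ℂ) : HasDerivAt (chebT n) (n * chebU n x) x := by
  rw [← chebT'_eq]
  exact Polynomial.hasDerivAt _ x

theorem hasDerivAt_chebU (n : ℕ) {x : ℂ} (hx : 1 - x ^ 2 ≠ 0) :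
    HasDerivAt (chebU n) ((x * chebU n x - n * chebT n x) / (1 - x ^ 2)) x := by
  rw [← one_sub_sq_mul_chebU', mul_div_cancel_left₀ _ hx]
  exact Polynomial.hasDerivAt _ x

theorem continuous_chebT (n : ℕ) : Continuous (chebT n) := Polynomial.continuous _

theorem continuous_chebU (n : ℕ) : Continuous (chebU n) := Polynomial.continuous _

theorem hasDerivAt_one_sub_sq (x : ℂ) : HasDerivAt (fun y : ℂ => 1 - y ^ 2) (-(2 * x)) x := by
  simpa using (hasDerivAt_pow 2 x).const_sub 1

theorem hasDerivAt_one_sub_sq_mul_chebU (n : ℕ) {x : ℂ} (hx : 1 - x ^ 2 ≠ 0) :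
    HasDerivAt (fun y => (1 - y ^ 2) * chebU n y) (-(x * chebU n x + n * chebT n x)) x := by
  refine ((hasDerivAt_one_sub_sq x).fun_mul (hasDerivAt_chebU n hx)).congr_deriv ?_
  field_simp
  ring

theorem hasDerivAt_one_sub_sq_mul_chebT (n : ℕ) (x : ℂ) :
    HasDerivAt (fun y => (1 - y ^ 2) * chebT n y)
      (-(2 * x) * chebT n x + (1 - x ^ 2) * (n * chebU n x)) x :=
  (hasDerivAt_one_sub_sq x).fun_mul (hasDerivAt_chebT n x)

theorem IsSqrtBranch.hasDerivAt_chebU_mul {Ω : Set ℂ} {s : ℂ → ℂ} (h : IsSqrtBranch Ω s) (n : ℕ)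
    {x : ℂ} (hx : x ∈ Ω) :
    HasDerivAt (fun y => chebU n y * s y) (-(n * chebT n x * s x) / (1 - x ^ 2)) x := by
  have hq := h.one_sub_sq_ne_zero hx
  refine ((hasDerivAt_chebU n hq).fun_mul (h.hasDerivAt hx)).congr_deriv ?_
  field_simp
  ring

theorem IsSqrtBranch.hasDerivAt_chebT_mul {Ω : Set ℂ} {s : ℂ → ℂ} (h : IsSqrtBranch Ω s) (n : ℕ)
    {x : ℂ} (hx : x ∈ Ω) :
    HasDerivAt (fun y => chebT n y * s y)
      (n * chebU n x * s x + chebT n x * (-x * s x / (1 - x ^ 2))) x :=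
  (hasDerivAt_chebT n x).fun_mul (h.hasDerivAt hx)

/-! ### The quadratic system -/

theorem quadraticDen_eq (n : ℕ) (μ : ℂ) (p : ℂ × ℂ) :
    quadraticDen n μ p =
      μ * chebT n p.2 * p.1 + n * ((1 - p.2 ^ 2) * chebU n p.2) := by
  rw [quadraticDen, chebT'_eq]
  ring

/-- The system is the Riccati equation of `v = -(1-x²) y' / (μ y)`. The integral is `((1-x²) Y' + μ
v Y) / ((1-x²) T' + μ v T)`, with `(1-x²) Y' = -n T s`. -/
theorem isFirstIntegral_quadratic {n : ℕ} (hn : 1 ≤ n) {μ : ℂ} (hμ : μ ≠ 0) {Ω : Set ℂ}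
    {s : ℂ → ℂ} (h : IsSqrtBranch Ω s) :
    IsFirstIntegral (quadraticField n μ) (quadraticDomain n μ Ω) (quadraticIntegral n μ s) := by
  have hn0 : (n : ℂ) ≠ 0 := Nat.cast_ne_zero.mpr (by omega)
  have hT := continuous_chebT n
  have hU := continuous_chebU n
  have hq : ∀ p ∈ quadraticDomain n μ Ω, 1 - p.2 ^ 2 ≠ 0 := fun p hp =>
    h.one_sub_sq_ne_zero hp.1
  refine isFirstIntegral_of_moebius
    (a := fun x => μ * (chebU n x * s x)) (b := fun x => -n * (chebT n x * s x))
    (c := fun x => μ * chebT n x) (e := fun x => n * ((1 - x ^ 2) * chebU n x))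
    (da := fun x => μ * (-(n * chebT n x * s x) / (1 - x ^ 2)))
    (db := fun x => -n * (n * chebU n x * s x + chebT n x * (-x * s x / (1 - x ^ 2))))
    (dc := fun x => μ * (n * chebU n x)) (de := fun x => n * -(x * chebU n x + n * chebT n x))
    ?_ ?_ (fun p hp => (h.hasDerivAt_chebU_mul n hp.1).const_mul _)
    (fun p hp => (h.hasDerivAt_chebT_mul n hp.1).const_mul _)
    (fun p _ => (hasDerivAt_chebT n p.2).const_mul _)
    (fun p hp => (hasDerivAt_one_sub_sq_mul_chebU n (hq p hp)).const_mul _)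
    ?_ ?_ ?_ ?_
  · have : quadraticDomain n μ Ω = (Prod.snd ⁻¹' Ω) ∩
        {p | μ * chebT n p.2 * p.1 + n * ((1 - p.2 ^ 2) * chebU n p.2) ≠ 0} := by
      ext p
      simp [quadraticDomain, quadraticDen_eq]
    rw [this]
    exact (h.isOpen.preimage continuous_snd).inter (isOpen_ne_fun (by fun_prop) (by fun_prop))
  · obtain ⟨x, hx, hTx⟩ := exists_mem_eval_ne_zero h.isOpen h.nonempty (chebyshevT_ne_zero n)
    change chebT n x ≠ 0 at hTx
    -- This value of `v` makes the denominator equal to `1`.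
    refine ⟨((1 - n * ((1 - x ^ 2) * chebU n x)) / (μ * chebT n x), x), hx, ?_⟩
    rw [quadraticDen_eq]
    simp only
    rw [mul_div_cancel₀ _ (mul_ne_zero hμ hTx)]
    simp
  · intro p hp
    rw [← quadraticDen_eq]
    exact hp.2
  · intro p hp
    have : μ * (chebU n p.2 * s p.2) * (n * ((1 - p.2 ^ 2) * chebU n p.2))
        - -n * (chebT n p.2 * s p.2) * (μ * chebT n p.2) = μ * n * s p.2 := by
      linear_combination μ * n * s p.2 * cheb_pell n p.2
    rw [this]
    exact mul_ne_zero (mul_ne_zero hμ hn0) (h.ne_zero hp.1)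
  · intro p hp
    rw [quadraticIntegral, quadraticDen_eq, div_mul_eq_mul_div]
    congr 1
    linear_combination s p.2 * one_sub_sq_mul_chebU' n p.2
  · intro p hp
    have hqp := hq p hp
    simp only [quadraticField]
    field_simp
    ring

/-! ### The reduced system -/

theorem two_mul_reducedDen (n : ℕ) {p : ℂ × ℂ} (hq : 1 - p.2 ^ 2 ≠ 0) (hT : chebT n p.2 ≠ 0) :
    2 * (1 - p.2 ^ 2) * chebT n p.2 * reducedDen n p =
      -2 * ((1 - p.2 ^ 2) * chebT n p.2) * p.1
        + (2 * n * ((1 - p.2 ^ 2) * chebU n p.2) - p.2 * chebT n p.2) := by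
  rw [reducedDen, chebT'_eq]
  field_simp
  ring

/-- Here `w = z'/z` for `z = (1-x²)^(1/4) y`, which removes the first-order term; this explains the
shift `x / (2(1-x²))`. For `Y` the factor `s` adds `x / (1-x²)`, making it `3x / (2(1-x²))`. -/
theorem isFirstIntegral_reduced {n : ℕ} (hn : 1 ≤ n) {Ω : Set ℂ} {s : ℂ → ℂ}
    (h : IsSqrtBranch Ω s) :
    IsFirstIntegral (reducedField n) (reducedDomain n Ω) (reducedIntegral n s) := by
  have hn0 : (n : ℂ) ≠ 0 := Nat.cast_ne_zero.mpr (by omega)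
  have hT := continuous_chebT n
  have hU := continuous_chebU n
  have hden : ∀ p ∈ reducedDomain n Ω, -2 * ((1 - p.2 ^ 2) * chebT n p.2) * p.1
      + (2 * n * ((1 - p.2 ^ 2) * chebU n p.2) - p.2 * chebT n p.2) ≠ 0 := by
    rintro p ⟨-, hq, hT, -, hd⟩
    rw [← two_mul_reducedDen n hq hT]
    exact mul_ne_zero (mul_ne_zero (mul_ne_zero two_ne_zero hq) hT) hd
  -- The coefficients arise by multiplying numerator and denominator by `2(1-x²) T` and eliminating
  -- `T'` and `U'`.
  refine isFirstIntegral_of_moebius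
    (a := fun x => -2 * ((1 - x ^ 2) * (chebU n x * s x)))
    (b := fun x => (-2 * n) * (chebT n x * s x) - x * (chebU n x * s x))
    (c := fun x => -2 * ((1 - x ^ 2) * chebT n x))
    (e := fun x => 2 * n * ((1 - x ^ 2) * chebU n x) - x * chebT n x)
    (da := fun x => -2 * (-(2 * x) * (chebU n x * s x)
      + (1 - x ^ 2) * (-(n * chebT n x * s x) / (1 - x ^ 2))))
    (db := fun x => (-2 * n) * (n * chebU n x * s x + chebT n x * (-x * s x / (1 - x ^ 2)))
      - (1 * (chebU n x * s x) + x * (-(n * chebT n x * s x) / (1 - x ^ 2))))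
    (dc := fun x => -2 * (-(2 * x) * chebT n x + (1 - x ^ 2) * (n * chebU n x)))
    (de := fun x => 2 * n * -(x * chebU n x + n * chebT n x)
      - (1 * chebT n x + x * (n * chebU n x)))
    ?_ ?_
    (fun p hp => ((hasDerivAt_one_sub_sq p.2).fun_mul
      (h.hasDerivAt_chebU_mul n hp.1)).const_mul _)
    (fun p hp => ((h.hasDerivAt_chebT_mul n hp.1).const_mul _).fun_sub
      ((hasDerivAt_id' p.2).fun_mul (h.hasDerivAt_chebU_mul n hp.1)))
    (fun p _ => (hasDerivAt_one_sub_sq_mul_chebT n p.2).const_mul _)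
    (fun p hp => ((hasDerivAt_one_sub_sq_mul_chebU n hp.2.1).const_mul _).fun_sub
      ((hasDerivAt_id' p.2).fun_mul (hasDerivAt_chebT n p.2)))
    hden ?_ ?_ ?_
  · have : reducedDomain n Ω = (Prod.snd ⁻¹' Ω) ∩ ({p | 1 - p.2 ^ 2 ≠ 0} ∩
        ({p | chebT n p.2 ≠ 0} ∩ ({p | chebU n p.2 ≠ 0} ∩
        {p | -2 * ((1 - p.2 ^ 2) * chebT n p.2) * p.1
          + (2 * n * ((1 - p.2 ^ 2) * chebU n p.2) - p.2 * chebT n p.2) ≠ 0}))) := by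
      ext p
      refine and_congr_right fun _ => and_congr_right fun hq => and_congr_right fun hT =>
        and_congr_right fun _ => ?_
      simp only [Set.mem_ofPred_eq]
      rw [← two_mul_reducedDen n hq hT, mul_ne_zero_iff,
        and_iff_right (mul_ne_zero (mul_ne_zero two_ne_zero hq) hT)]
    rw [this]
    refine (h.isOpen.preimage continuous_snd).inter ?_
    refine (isOpen_ne_fun (by fun_prop) (by fun_prop)).inter ?_
    refine (isOpen_ne_fun (by fun_prop) (by fun_prop)).inter ?_
    exact (isOpen_ne_fun (by fun_prop) (by fun_prop)).inter
      (isOpen_ne_fun (by fun_prop) (by fun_prop))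
  · obtain ⟨x, hx, hTU⟩ := exists_mem_eval_ne_zero h.isOpen h.nonempty
      (mul_ne_zero (chebyshevT_ne_zero n) (chebyshevU_ne_zero hn))
    rw [eval_mul] at hTU
    -- This value of `w` makes `reducedDen` equal to `1`.
    refine ⟨(chebT' n x / chebT n x - x / (2 * (1 - x ^ 2)) - 1, x), hx,
      h.one_sub_sq_ne_zero hx, left_ne_zero_of_mul hTU, right_ne_zero_of_mul hTU, ?_⟩
    rw [reducedDen]
    ring_nf
    exact one_ne_zero
  · intro p hp
    have : -2 * ((1 - p.2 ^ 2) * (chebU n p.2 * s p.2))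
          * (2 * n * ((1 - p.2 ^ 2) * chebU n p.2) - p.2 * chebT n p.2)
        - ((-2 * n) * (chebT n p.2 * s p.2) - p.2 * (chebU n p.2 * s p.2))
          * (-2 * ((1 - p.2 ^ 2) * chebT n p.2)) = -4 * n * ((1 - p.2 ^ 2) * s p.2) := by
      linear_combination -4 * n * ((1 - p.2 ^ 2) * s p.2) * cheb_pell n p.2
    rw [this]
    exact mul_ne_zero (mul_ne_zero (by norm_num) hn0) (mul_ne_zero hp.2.1 (h.ne_zero hp.1))
  · rintro p hp
    obtain ⟨hx, hq, hT0, hU0, hd⟩ := id hp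
    rw [reducedIntegral, eq_div_iff (hden p hp), ← two_mul_reducedDen n hq hT0]
    field_simp
    linear_combination 2 * s p.2 * one_sub_sq_mul_chebU' n p.2
  · rintro p ⟨hx, hq, -, -, -⟩
    simp only [reducedField]
    field_simp
    ring

end ChebyshevGalois

end
theorem mainTheorem3 (n : ℕ) (hn : 1 ≤ n) :
    -- a Picard–Vessiot extension of `ℂ(x)` for the Chebyshev equation exists, and
    -- for every such extension the differential Galois group is `ℤ/2`
    (∃ (L : Type) (_ : Field L) (_ : Differential L) (_ : Algebra (RatFunc ℂ) L)
        (_ : DifferentialAlgebra (RatFunc ℂ) L),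
        ChebyshevGalois.IsPicardVessiot L ChebyshevGalois.chebA (ChebyshevGalois.chebB n)) ∧
    (∀ (L : Type*) [Field L] [Differential L] [Algebra (RatFunc ℂ) L]
        [DifferentialAlgebra (RatFunc ℂ) L],
        ChebyshevGalois.IsPicardVessiot L ChebyshevGalois.chebA (ChebyshevGalois.chebB n) →
        Nonempty (ChebyshevGalois.diffGaloisGroup (RatFunc ℂ) L ≃* Multiplicative (ZMod 2))) ∧
    -- the first integrals, for every local holomorphic branch `s` of `√(1 - x²)`
    (∀ (Ω : Set ℂ) (s : ℂ → ℂ), ChebyshevGalois.IsSqrtBranch Ω s →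
        ChebyshevGalois.IsFirstIntegral (ChebyshevGalois.reducedField n)
          (ChebyshevGalois.reducedDomain n Ω) (ChebyshevGalois.reducedIntegral n s)) ∧
    (∀ (μ : ℂ), μ ≠ 0 → ∀ (Ω : Set ℂ) (s : ℂ → ℂ), ChebyshevGalois.IsSqrtBranch Ω s →
        ChebyshevGalois.IsFirstIntegral (ChebyshevGalois.quadraticField n μ)
          (ChebyshevGalois.quadraticDomain n μ Ω) (ChebyshevGalois.quadraticIntegral n μ s)) := by
  refine ⟨ChebyshevGalois.exists_isPicardVessiot hn, ?_,
    fun Ω s h => ChebyshevGalois.isFirstIntegral_reduced hn h,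
    fun μ hμ Ω s h => ChebyshevGalois.isFirstIntegral_quadratic hn hμ h⟩
  intro L _ _ _ _ h
  obtain ⟨s, hs⟩ := h.exists_sqrt
  exact ChebyshevGalois.nonempty_diffGaloisGroup_mulEquiv hs (h.adjoin_sqrt_eq_top hn hs)
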